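/- Let $X$ be a real normed space and let $F\subseteq X^*$ be a norming subspace, i.e. a linear subspace such that $\|x\|_F=\sup\{|f(x)| : f\in F,\ \|f\|\le 1\}$ defines a norm on $X$ equivalent to the original one. Let $\sigma(X,F)$ be the weakest topology on $X$ that makes every $f\in F$ continuous. The following are equivalent: (1) There is an equivalent $\sigma(X,F)$-lower semicontinuous norm $\|\cdot\|_A$ on $X$ such that for all sequences $(x_n),(y_n)$ in $X$ and all $x\in X$, if $$\lim_{n\to\infty}\bigl(2\|x_n\|_A^2+2\|y_n\|_A^2-\|x_n+y_n\|_A^2\bigr)=\lim_{n\to\infty}\bigl(2\|x\|_A^2+2\|x_n\|_A^2-\|x+x_n\|_A^2\bigr)=0,$$ then $y_n\to x$ in $\sigma(X,F)$. (2) There are an equivalent $\sigma(X,F)$-lower semicontinuous norm $\|\cdot\|_M$ on $X$ and a metric $d$ on $X$, whose topology is finer than (or equal to) $\sigma(X,F)$, such that every point $x$ with $\|x\|_M=1$ is an $F$-denting point with respect to $d$: for every $\varepsilon>0$ there is a $\sigma(X,F)$-open half-space $H=\{y\in X : f(y)>a\}$, with $0\ne f\in F$ and $a\in\mathbb{R}$,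 such that $x\in H$ and $$\sup\{d(y,z) : y,z\in H,\ \|y\|_M\le 1,\ \|z\|_M\le 1\}<\varepsilon.$$ -/

import Mathlib

open Filter Topology
open scoped ENNReal

namespace Renorming

section

variable {X : Type*} [NormedAddCommGroup X] [NormedSpace ℝ X]

/-- The topology `σ(X, F)`: the weakest topology on `X` making every member of `F` continuous. -/
abbrev sigmaTopology (F : Submodule ℝ (StrongDual ℝ X)) : TopologicalSpace X :=
  ⨅ f : F, TopologicalSpace.induced (fun x : X => (f : StrongDual ℝ X) x) inferInstance

/-- `p` is comparable from both sides with the norm of `X`. -/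
def IsEquivalentToNorm (p : X → ℝ) : Prop :=
  ∃ c C : ℝ, 0 < c ∧ 0 < C ∧ ∀ x : X, c * ‖x‖ ≤ p x ∧ p x ≤ C * ‖x‖

/-- `‖x‖_B`, the supremum of `|f x|` over the members `f` of `F` in the dual unit ball `B`. -/
noncomputable def supNorm (F : Submodule ℝ (StrongDual ℝ X)) (x : X) : ℝ :=
  sSup {r : ℝ | ∃ f ∈ F, ‖f‖ ≤ 1 ∧ r = |f x|}

/-- `F` is a norming subspace of the dual. Being a supremum of seminorms, `supNorm F` is a
seminorm, and it is a norm as soon as it is equivalent to the norm of `X`. -/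
def IsNorming (F : Submodule ℝ (StrongDual ℝ X)) : Prop :=
  IsEquivalentToNorm (supNorm F)

/-- An equivalent norm on `X`; the lower bound makes the seminorm `p` a norm. -/
def IsEquivalentNorm (p : Seminorm ℝ X) : Prop :=
  IsEquivalentToNorm (fun x => p x)

/-- `p` is lower semicontinuous for `σ(X, F)`. -/
def IsSigmaLSC (F : Submodule ℝ (StrongDual ℝ X)) (p : Seminorm ℝ X) : Prop :=
  letI : TopologicalSpace X := sigmaTopology F
  LowerSemicontinuous (fun x : X => p x)

/-- `Q(x, y) = 2 p(x)² + 2 p(y)² - p(x + y)²`. -/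
def convexityDefect (p : Seminorm ℝ X) (x y : X) : ℝ :=
  2 * p x ^ 2 + 2 * p y ^ 2 - p (x + y) ^ 2

/-- `H` is a `σ(X, F)`-open half-space. -/
def IsOpenHalfSpace (F : Submodule ℝ (StrongDual ℝ X)) (H : Set X) : Prop :=
  ∃ f ∈ F, f ≠ 0 ∧ ∃ a : ℝ, H = {x : X | a < f x}

/-- The diameter of `S` with respect to `ρ`, with value `∞` when `ρ` is unbounded on `S`. -/
noncomputable def diam (ρ : X → X → ℝ) (S : Set X) : ℝ≥0∞ :=
  ⨆ y ∈ S, ⨆ z ∈ S, ENNReal.ofReal (ρ y z)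

/-- `x` is an `F`-denting point with respect to `ρ` of the unit ball of the norm `p`. -/
def IsDentingPoint (F : Submodule ℝ (StrongDual ℝ X)) (p : Seminorm ℝ X) (ρ : X → X → ℝ)
    (x : X) : Prop :=
  ∀ ε : ℝ, 0 < ε → ∃ H : Set X, IsOpenHalfSpace F H ∧ x ∈ H ∧
    diam ρ (H ∩ {y : X | p y ≤ 1}) < ENNReal.ofReal ε

end

end Renorming

/-! (1) ⇒ (2) keeps the norm `p`. Call two points of its unit sphere related at level `n` when one
`f ∈ F` with `f ≤ p` exceeds `1 - 1/(n+1)` at both. Then `p (y + z)` is nearly `2`, so the convexity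
defect is small, and (1) says that the two-step neighbourhoods of a point shrink to it in `σ(X, F)`.
This is Moore's criterion (`pseudoMetrizableSpace`), so the sphere is `σ(X, F)`-metrizable. Polar
coordinates carry the metric to `X` (`exists_denting_metric_of_polar`), and steep slices at a unit
vector are small for it.

(2) ⇒ (1) changes the norm. Denting supplies, for each precision `m`, slices of `d`-diameter at most
`1/(m+1)`; after rescaling they are cut by functionals in countably many sets `G m k`. Adding the
support functions of these sets to `p` in the `ℓ²` sense (`exists_norm_controlling_supportFun`)
gives a norm whose vanishing defect forces two sequences into common small slices
(`eventually_exists_common_functional`). Chaining `x`, `u n`, `v n` through two such slices makes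
the normalized `v n` converge to the normalized `x` for `d`, hence for `σ(X, F)`. -/

/-! ### Moore's metrization theorem. -/

/-- A sequence of symmetric open relations whose two-step neighbourhoods form neighbourhood
bases, as in Moore's metrization theorem. -/
structure IsMooreSequence {S : Type*} [TopologicalSpace S] (R : ℕ → S → S → Prop) : Prop where
  refl : ∀ n x, R n x x
  symm : ∀ n x y, R n x y → R n y x
  anti : ∀ m n, m ≤ n → ∀ x y, R n x y → R m x y
  isOpen : ∀ n x, IsOpen {y | R n x y}
  base : ∀ x, ∀ U ∈ 𝓝 x, ∃ n, ∀ y z, R n x y → R n y z → z ∈ U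

namespace IsMooreSequence

variable {S : Type*} [TopologicalSpace S] {R : ℕ → S → S → Prop}

/-- Around each point of `C i` take a ball whose two-step enlargement misses the other sets. If two
such balls met, weakening the finer relation to the coarser level would put one centre in the
two-step neighbourhood of the other. -/
theorem exists_disjoint_open (hR : IsMooreSequence R) {ι : Type*} (C : ι → Set S)
    (hC : ∀ i, ∀ x ∈ C i, ∃ U ∈ 𝓝 x, ∀ j, j ≠ i → ∀ y ∈ U, y ∉ C j) :
    ∃ V : ι → Set S, (∀ i, IsOpen (V i)) ∧ (∀ i, C i ⊆ V i) ∧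
      ∀ i j x, x ∈ V i → x ∈ V j → i = j := by
  have key : ∀ i x, ∃ n, x ∈ C i → ∀ y z, R n x y → R n y z → ∀ j, j ≠ i → z ∉ C j := by
    intro i x
    by_cases hx : x ∈ C i
    · obtain ⟨U, hU, hUC⟩ := hC i x hx
      obtain ⟨n, hn⟩ := hR.base x U hU
      exact ⟨n, fun _ y z h1 h2 j hj => hUC j hj z (hn y z h1 h2)⟩
    · exact ⟨0, fun h => absurd h hx⟩
  choose n hn using key
  refine ⟨fun i => ⋃ x ∈ C i, {y | R (n i x) x y}, fun i => ?_, fun i x hx => ?_, ?_⟩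
  · exact isOpen_biUnion fun x _ => hR.isOpen _ x
  · exact Set.mem_biUnion hx (hR.refl _ x)
  · intro i j z hi hj
    simp only [Set.mem_iUnion, Set.mem_ofPred_eq] at hi hj
    obtain ⟨x, hx, hxz⟩ := hi
    obtain ⟨y, hy, hyz⟩ := hj
    by_contra hij
    rcases le_total (n i x) (n j y) with h | h
    · exact hn i x hx z y hxz (hR.symm _ _ _ (hR.anti _ _ h _ _ hyz)) j (Ne.symm hij) hy
    · exact hn j y hy z x hyz (hR.symm _ _ _ (hR.anti _ _ h _ _ hxz)) i hij hx

theorem normalSpace (hR : IsMooreSequence R) : NormalSpace S where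
  normal s t hs ht hst := by
    obtain ⟨V, hVo, hCV, hV⟩ := hR.exists_disjoint_open (fun b : Bool => if b then s else t) (by
      rintro (_ | _) x hx
      · refine ⟨sᶜ, hs.isOpen_compl.mem_nhds fun h => Set.disjoint_left.1 hst h (by simpa using hx),
          ?_⟩
        rintro (_ | _) hj y hy <;> simp_all
      · refine ⟨tᶜ, ht.isOpen_compl.mem_nhds fun h => Set.disjoint_left.1 hst (by simpa using hx) h,
          ?_⟩
        rintro (_ | _) hj y hy <;> simp_all)
    refine ⟨V true, V false, hVo _, hVo _, by simpa using hCV true, by simpa using hCV false, ?_⟩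
    exact Set.disjoint_left.2 fun x h1 h2 => by simpa using hV _ _ x h1 h2

/-- A single Urysohn function, cut up along the disjoint sets `V i ∩ O i`, yields all bumps at once.
They are equicontinuous: inside one piece only one bump is nonzero, and outside all pieces the
Urysohn function itself vanishes. -/
theorem exists_discrete_bumps (hR : IsMooreSequence R) {ι : Type*} (E O : ι → Set S)
    (hE : ∀ x, ∃ U : Set S, IsOpen U ∧ x ∈ U ∧
      ∀ i j, (U ∩ E i).Nonempty → (U ∩ E j).Nonempty → i = j)
    (hO : ∀ i, IsOpen (O i)) (hEO : ∀ i, closure (E i) ⊆ O i) :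
    ∃ h : ι → S → ℝ, (∀ i, ∀ x ∈ E i, h i x = 1) ∧ (∀ i x, x ∉ O i → h i x = 0) ∧
      ∀ x, ∀ ε > 0, ∀ᶠ y in 𝓝 x, ∀ i, |h i x - h i y| < ε := by
  classical
  have := hR.normalSpace
  obtain ⟨V, hVo, hCV, hV⟩ := hR.exists_disjoint_open (fun i => closure (E i)) (by
    intro i x hx
    obtain ⟨U, hUo, hxU, hU⟩ := hE x
    refine ⟨U, hUo.mem_nhds hxU, fun j hj y hy hyj => hj ?_⟩
    exact hU j i (mem_closure_iff.1 hyj U hUo hy) (mem_closure_iff.1 hx U hUo hxU))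
  have hlf : LocallyFinite E := fun x => by
    obtain ⟨U, hUo, hxU, hU⟩ := hE x
    refine ⟨U, hUo.mem_nhds hxU, Set.Subsingleton.finite fun i hi j hj => hU i j ?_ ?_⟩
    · rwa [Set.inter_comm]
    · rwa [Set.inter_comm]
  have hclosed : IsClosed (⋃ i, closure (E i)) := hlf.closure.isClosed_iUnion fun _ => isClosed_closure
  have hWo : IsOpen (⋃ i, V i ∩ O i) := isOpen_iUnion fun i => (hVo i).inter (hO i)
  obtain ⟨f, hf0, hf1, hf01⟩ := exists_continuous_zero_one_of_isClosed hWo.isClosed_compl hclosed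
    (Set.disjoint_left.2 fun x hx hx' => hx (by
      obtain ⟨i, hi⟩ := Set.mem_iUnion.1 hx'
      exact Set.mem_iUnion.2 ⟨i, hCV i hi, hEO i hi⟩))
  have h0le : ∀ x, 0 ≤ f x := fun x => (hf01 x).1
  refine ⟨fun i x => if x ∈ V i ∩ O i then f x else 0, ?_, ?_, ?_⟩
  · intro i x hx
    have hx' := subset_closure hx
    simp only [if_pos (show x ∈ V i ∩ O i from ⟨hCV i hx', hEO i hx'⟩)]
    exact hf1 (Set.mem_iUnion.2 ⟨i, hx'⟩)
  · intro i x hx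
    exact if_neg fun h => hx h.2
  · intro x ε hε
    have hfx : ∀ᶠ y in 𝓝 x, |f x - f y| < ε := by
      have := (Metric.tendsto_nhds.1 (f.continuous.tendsto x)) ε hε
      filter_upwards [this] with y hy
      rwa [abs_sub_comm, ← Real.dist_eq]
    by_cases hx : x ∈ ⋃ i, V i ∩ O i
    · obtain ⟨i, hi⟩ := Set.mem_iUnion.1 hx
      filter_upwards [hfx, ((hVo i).inter (hO i)).mem_nhds hi] with y hy hyi j
      by_cases hji : j = i
      · subst hji; simpa only [if_pos hi, if_pos hyi] using hy
      · have h1 : x ∉ V j ∩ O j := fun h => hji (hV _ _ _ h.1 hi.1)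
        have h2 : y ∉ V j ∩ O j := fun h => hji (hV _ _ _ h.1 hyi.1)
        simpa only [if_neg h1, if_neg h2, sub_zero, abs_zero] using hε
    · filter_upwards [hfx] with y hy j
      have h1 : x ∉ V j ∩ O j := fun h => hx (Set.mem_iUnion.2 ⟨j, h⟩)
      have hfx0 : f x = 0 := hf0 hx
      simp only [if_neg h1]
      split_ifs
      · rwa [hfx0] at hy
      · simpa using hε

/-- Moore's metrization theorem. -/
theorem pseudoMetrizableSpace (hR : IsMooreSequence R) :
    TopologicalSpace.PseudoMetrizableSpace S := by
  classical
  obtain ⟨_, wo⟩ := exists_wellFoundedLT S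
  -- Stone's device: a point goes to the first centre, in a well-order of `S`, whose ball contains
  -- it. The two-step condition makes the family discrete for each fixed pair of levels.
  let E : ℕ × ℕ → S → Set S := fun p i =>
    {x | (∀ y z, R p.2 x y → R p.2 y z → R p.1 i z) ∧ ∀ j < i, ¬ R p.1 j x}
  have key : ∀ p : ℕ × ℕ, ∃ h : S → S → ℝ, (∀ i, ∀ x ∈ E p i, h i x = 1) ∧
      (∀ i x, ¬ R p.1 i x → h i x = 0) ∧
      ∀ x, ∀ ε > 0, ∀ᶠ y in 𝓝 x, ∀ i, |h i x - h i y| < ε := by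
    intro p
    refine hR.exists_discrete_bumps (E p) (fun i => {x | R p.1 i x}) ?_ (fun i => hR.isOpen _ i) ?_
    · intro z
      refine ⟨{y | R p.2 z y}, hR.isOpen _ z, hR.refl _ z, ?_⟩
      have aux : ∀ i j, i < j → ({y | R p.2 z y} ∩ E p i).Nonempty →
          ({y | R p.2 z y} ∩ E p j).Nonempty → False := by
        rintro i j hij ⟨x, hzx, hx⟩ ⟨y, hzy, hy⟩
        exact hy.2 i hij (hx.1 z y (hR.symm _ _ _ hzx) hzy)
      intro i j hi hj
      rcases lt_trichotomy i j with h | h | h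
      · exact (aux i j h hi hj).elim
      · exact h
      · exact (aux j i h hj hi).elim
    · intro i x hx
      obtain ⟨y, hxy, hy⟩ := mem_closure_iff.1 hx _ (hR.isOpen p.2 x) (hR.refl _ x)
      exact hy.1 y x (hR.refl _ y) (hR.symm _ _ _ hxy)
  choose h h1 h0 hc using key
  -- The bumps embed the topology of `S` in a countable product of spaces of uniform convergence;
  -- equicontinuity is what makes `Θ` continuous.
  let Θ : S → ℕ × ℕ → UniformFun S ℝ := fun x p => UniformFun.ofFun fun i => h p i x
  have hcount : IsCountablyGenerated (uniformity (UniformFun S ℝ)) :=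
    (UniformFun.hasBasis_uniformity_of_basis S ℝ
      (uniformity ℝ).exists_antitone_basis.choose_spec.toHasBasis).isCountablyGenerated
  have hΘ : IsInducing Θ := by
    refine isInducing_iff_nhds.2 fun x => le_antisymm ?_ ?_
    · rw [← tendsto_iff_comap, tendsto_pi_nhds]
      intro p
      rw [UniformFun.tendsto_iff_tendstoUniformly, Metric.tendstoUniformly_iff]
      intro ε hε
      filter_upwards [hc p x ε hε] with y hy i
      exact hy i
    · intro U hU
      obtain ⟨n, hn⟩ := hR.base x U hU
      have hne : {i | R n i x}.Nonempty := ⟨x, hR.refl n x⟩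
      let i := wellFounded_lt.min {i | R n i x} hne
      have hi : R n i x := wellFounded_lt.min_mem _ hne
      have hmin : ∀ j < i, ¬ R n j x := fun j hj hjx =>
        wellFounded_lt.not_lt_min {i | R n i x} hjx hj
      obtain ⟨k, hk⟩ := hR.base x _ ((hR.isOpen n i).mem_nhds hi)
      have hxE : x ∈ E (n, k) i := ⟨hk, hmin⟩
      have hcont : Continuous fun g : ℕ × ℕ → UniformFun S ℝ => UniformFun.toFun (g (n, k)) i :=
        (UniformFun.uniformContinuous_eval ℝ i).continuous.comp (continuous_apply (n, k))
      have hpos : 0 < UniformFun.toFun (Θ x (n, k)) i := by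
        change 0 < h (n, k) i x
        rw [h1 _ _ _ hxE]; exact one_pos
      refine mem_comap.2 ⟨_, (isOpen_lt continuous_const hcont).mem_nhds hpos, fun y hy => ?_⟩
      have hy' : 0 < h (n, k) i y := hy
      have hiy : R n i y := by
        by_contra hcon
        rw [h0 (n, k) i y hcon] at hy'
        exact lt_irrefl _ hy'
      exact hn i y (hR.symm _ _ _ hi) hiy
  have : TopologicalSpace.PseudoMetrizableSpace (UniformFun S ℝ) :=
    UniformSpace.pseudoMetrizableSpace
  exact hΘ.pseudoMetrizableSpace

end IsMooreSequence

/-! ### Stability of lower semicontinuity. -/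

theorem LowerSemicontinuous.sq_of_nonneg {α : Type*} [TopologicalSpace α] {f : α → ℝ}
    (hf : LowerSemicontinuous f) (h0 : ∀ x, 0 ≤ f x) : LowerSemicontinuous fun x => f x ^ 2 := by
  have hg : Monotone fun t : ℝ => max t 0 ^ 2 := fun a b hab =>
    pow_le_pow_left₀ (le_max_right _ _) (max_le_max_right 0 hab) 2
  have := (show Continuous fun t : ℝ => max t 0 ^ 2 by fun_prop).comp_lowerSemicontinuous hf hg
  simpa only [Function.comp_def, max_eq_left (h0 _)] using this

theorem LowerSemicontinuous.sqrt_add {α : Type*} [TopologicalSpace α] {f g : α → ℝ}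
    (hf : LowerSemicontinuous f) (hg : LowerSemicontinuous g) :
    LowerSemicontinuous fun x => √(f x + g x) :=
  Real.continuous_sqrt.comp_lowerSemicontinuous (hf.add hg) fun _ _ hab => Real.sqrt_le_sqrt hab

theorem LowerSemicontinuous.nonneg_mul {α : Type*} [TopologicalSpace α] {f : α → ℝ}
    (hf : LowerSemicontinuous f) {c : ℝ} (hc : 0 ≤ c) : LowerSemicontinuous fun x => c * f x :=
  (continuous_const_mul c).comp_lowerSemicontinuous hf fun _ _ hab =>
    mul_le_mul_of_nonneg_left hab hc

theorem LowerSemicontinuous.sqrt_tsum_sq {α : Type*} [TopologicalSpace α] {f : ℕ → α → ℝ}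
    (hf : ∀ n, LowerSemicontinuous (f n)) (h0 : ∀ n x, 0 ≤ f n x)
    (hs : ∀ x, Summable fun n => f n x ^ 2) :
    LowerSemicontinuous fun x => √(∑' n, f n x ^ 2) := by
  refine Real.continuous_sqrt.comp_lowerSemicontinuous ?_ fun a b hab => Real.sqrt_le_sqrt hab
  have hpart : ∀ N, LowerSemicontinuous fun x => ∑ n ∈ Finset.range N, f n x ^ 2 := fun N =>
    lowerSemicontinuous_sum fun n _ => (hf n).sq_of_nonneg (h0 n)
  refine lowerSemicontinuous_iff_isClosed_preimage.2 fun r => ?_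
  have : (fun x => ∑' n, f n x ^ 2) ⁻¹' Set.Iic r =
      ⋂ N, (fun x => ∑ n ∈ Finset.range N, f n x ^ 2) ⁻¹' Set.Iic r := by
    ext x
    simp only [Set.mem_preimage, Set.mem_Iic, Set.mem_iInter]
    exact ⟨fun h N => ((hs x).sum_le_tsum _ fun n _ => sq_nonneg _).trans h,
      fun h => (hs x).tsum_le_of_sum_range_le h⟩
  rw [this]
  exact isClosed_iInter fun N => (hpart N).isClosed_preimage r

/-! ### Support functions and `ℓ²`-sums of seminorms. -/

namespace Renorming

variable {X : Type*} [NormedAddCommGroup X] [NormedSpace ℝ X]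

theorem sq_sub_le_of_add_le {a b c : ℝ} (hc : 0 ≤ c) (h : c ≤ a + b) :
    (a - b) ^ 2 ≤ 2 * a ^ 2 + 2 * b ^ 2 - c ^ 2 := by
  nlinarith [pow_le_pow_left₀ hc h 2]

theorem convexityDefect_nonneg (p : Seminorm ℝ X) (x y : X) : 0 ≤ convexityDefect p x y :=
  (sq_nonneg _).trans (sq_sub_le_of_add_le (apply_nonneg p _) (map_add_le_add p x y))

/-- The `ℓ²`-combination of a sequence of seminorms. -/
theorem exists_seminorm_sq_eq_tsum (q : ℕ → Seminorm ℝ X)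
    (hs : ∀ x, Summable fun n => q n x ^ 2) :
    ∃ A : Seminorm ℝ X, ∀ x, A x = √(∑' n, q n x ^ 2) := by
  refine ⟨Seminorm.of (fun x => √(∑' n, q n x ^ 2)) (fun x y => ?_) (fun a x => ?_), fun x => rfl⟩
  · have h := Real.Lp_add_le_tsum_of_nonneg (p := 2) one_le_two (f := fun n => q n x)
      (g := fun n => q n y) (fun n => apply_nonneg _ _) (fun n => apply_nonneg _ _)
      (by simpa only [Real.rpow_two] using hs x) (by simpa only [Real.rpow_two] using hs y)
    simp only [Real.rpow_two, ← Real.sqrt_eq_rpow] at h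
    refine (Real.sqrt_le_sqrt ?_).trans h.2
    exact (hs (x + y)).tsum_le_tsum
      (fun n => pow_le_pow_left₀ (apply_nonneg _ _) (map_add_le_add _ _ _) 2) h.1
  · have : ∀ n, q n (a • x) ^ 2 = ‖a‖ ^ 2 * q n x ^ 2 := fun n => by
      rw [map_smul_eq_mul, mul_pow]
    simp only [this, tsum_mul_left]
    rw [Real.sqrt_mul (sq_nonneg _), Real.sqrt_sq (norm_nonneg _)]

/-- The support function of a set of functionals. -/
noncomputable def supportFun (G : Set (StrongDual ℝ X)) (x : X) : ℝ :=
  ⨆ g : G, (g : StrongDual ℝ X) x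

section supportFun

variable {G : Set (StrongDual ℝ X)}

theorem bddAbove_range_apply (hG : ∀ g ∈ G, ‖g‖ ≤ 1) (x : X) :
    BddAbove (Set.range fun g : G => (g : StrongDual ℝ X) x) := by
  refine ⟨‖x‖, ?_⟩
  rintro _ ⟨g, rfl⟩
  exact (le_abs_self _).trans ((g.1.le_opNorm x).trans
    (mul_le_of_le_one_left (norm_nonneg x) (hG _ g.2)))

theorem le_supportFun (hG : ∀ g ∈ G, ‖g‖ ≤ 1) {g : StrongDual ℝ X} (hg : g ∈ G) (x : X) :
    g x ≤ supportFun G x :=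
  le_ciSup (bddAbove_range_apply hG x) ⟨g, hg⟩

theorem exists_lt_of_lt_supportFun (h0 : (0 : StrongDual ℝ X) ∈ G) {r : ℝ} {x : X}
    (h : r < supportFun G x) : ∃ g ∈ G, r < g x := by
  have : Nonempty G := ⟨⟨0, h0⟩⟩
  obtain ⟨g, hg⟩ := exists_lt_of_lt_ciSup h
  exact ⟨g, g.2, hg⟩

theorem supportFun_nonneg (hG : ∀ g ∈ G, ‖g‖ ≤ 1) (h0 : (0 : StrongDual ℝ X) ∈ G) (x : X) :
    0 ≤ supportFun G x :=
  le_supportFun hG h0 x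

theorem supportFun_le_norm (hG : ∀ g ∈ G, ‖g‖ ≤ 1) (h0 : (0 : StrongDual ℝ X) ∈ G) (x : X) :
    supportFun G x ≤ ‖x‖ := by
  have : Nonempty G := ⟨⟨0, h0⟩⟩
  exact ciSup_le fun g => (le_abs_self _).trans ((g.1.le_opNorm x).trans
    (mul_le_of_le_one_left (norm_nonneg x) (hG _ g.2)))

theorem supportFun_add_le (hG : ∀ g ∈ G, ‖g‖ ≤ 1) (h0 : (0 : StrongDual ℝ X) ∈ G) (x y : X) :
    supportFun G (x + y) ≤ supportFun G x + supportFun G y := by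
  have : Nonempty G := ⟨⟨0, h0⟩⟩
  refine ciSup_le fun g => ?_
  rw [map_add]
  exact add_le_add (le_supportFun hG g.2 x) (le_supportFun hG g.2 y)

theorem supportFun_smul {a : ℝ} (ha : 0 ≤ a) (x : X) :
    supportFun G (a • x) = a * supportFun G x := by
  simp only [supportFun, map_smul, smul_eq_mul, Real.mul_iSup_of_nonneg ha]

theorem continuous_sigma {F : Submodule ℝ (StrongDual ℝ X)} {g : StrongDual ℝ X} (hg : g ∈ F) :
    @Continuous X ℝ (sigmaTopology F) _ g :=
  continuous_iInf_dom (i := (⟨g, hg⟩ : F)) continuous_induced_dom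

theorem lowerSemicontinuous_supportFun (hG : ∀ g ∈ G, ‖g‖ ≤ 1)
    {F : Submodule ℝ (StrongDual ℝ X)} (hGF : G ⊆ F) :
    @LowerSemicontinuous X ℝ (sigmaTopology F) _ (supportFun G) :=
  @lowerSemicontinuous_ciSup X (sigmaTopology F) _ _ _ _ (bddAbove_range_apply hG) fun g =>
    @Continuous.lowerSemicontinuous X (sigmaTopology F) _ _ _ _ _ (continuous_sigma (hGF g.2))

theorem lowerSemicontinuous_supportFun_neg (hG : ∀ g ∈ G, ‖g‖ ≤ 1)
    {F : Submodule ℝ (StrongDual ℝ X)} (hGF : G ⊆ F) :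
    @LowerSemicontinuous X ℝ (sigmaTopology F) _ fun x => supportFun G (-x) :=
  @lowerSemicontinuous_ciSup X (sigmaTopology F) _ _ _ _ (fun x => bddAbove_range_apply hG (-x))
    fun g => by
      simp only [map_neg]
      exact @Continuous.lowerSemicontinuous X (sigmaTopology F) _ _ _ _ _
        (@Continuous.comp X ℝ ℝ (sigmaTopology F) _ _ _ _ continuous_neg (continuous_sigma (hGF g.2)))

/-- `G` need not be symmetric, so its support function is only sublinear. Combining it with its
reflection in the `ℓ²` sense makes the defect of `q` a sum of two nonnegative defects; the triangle
inequality is Minkowski's in the plane. -/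
theorem exists_seminorm_sq_eq_supportFun (hG : ∀ g ∈ G, ‖g‖ ≤ 1) (h0 : (0 : StrongDual ℝ X) ∈ G) :
    ∃ q : Seminorm ℝ X, ∀ x, q x = √(supportFun G x ^ 2 + supportFun G (-x) ^ 2) := by
  refine ⟨Seminorm.of (fun x => √(supportFun G x ^ 2 + supportFun G (-x) ^ 2))
    (fun x y => ?_) (fun a x => ?_), fun x => rfl⟩
  · have h1 := supportFun_add_le hG h0 x y
    have h2 := supportFun_add_le hG h0 (-x) (-y)
    rw [← neg_add] at h2
    have e1 := supportFun_nonneg hG h0 (x + y)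
    have e2 := supportFun_nonneg hG h0 (-(x + y))
    set a := supportFun G x
    set b := supportFun G y
    set c := supportFun G (-x)
    set e := supportFun G (-y)
    have hs := Real.sq_sqrt (show 0 ≤ a ^ 2 + c ^ 2 by positivity)
    have ht := Real.sq_sqrt (show 0 ≤ b ^ 2 + e ^ 2 by positivity)
    have hs0 := Real.sqrt_nonneg (a ^ 2 + c ^ 2)
    have ht0 := Real.sqrt_nonneg (b ^ 2 + e ^ 2)
    set s := √(a ^ 2 + c ^ 2)
    set t := √(b ^ 2 + e ^ 2)
    have hcs : a * b + c * e ≤ s * t := by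
      refine abs_le_of_sq_le_sq' ?_ (mul_nonneg hs0 ht0) |>.2
      rw [mul_pow, hs, ht]
      nlinarith [sq_nonneg (a * e - b * c)]
    refine Real.sqrt_le_iff.2 ⟨by positivity, ?_⟩
    nlinarith [pow_le_pow_left₀ e1 h1 2, pow_le_pow_left₀ e2 h2 2]
  · rcases le_total 0 a with ha | ha
    · simp only [← smul_neg, supportFun_smul ha, mul_pow, ← mul_add]
      rw [Real.sqrt_mul (sq_nonneg _), Real.sqrt_sq ha, Real.norm_of_nonneg ha]
    · have ha' : 0 ≤ -a := neg_nonneg.2 ha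
      have e1 : supportFun G (a • x) = -a * supportFun G (-x) := by
        rw [← supportFun_smul ha', smul_neg, neg_smul, neg_neg]
      have e2 : supportFun G (-(a • x)) = -a * supportFun G x := by
        rw [← supportFun_smul ha', neg_smul]
      simp only [e1, e2, mul_pow, ← mul_add]
      rw [Real.sqrt_mul (sq_nonneg _), Real.sqrt_sq ha', Real.norm_of_nonpos ha, add_comm]

end supportFun

/-- The defect is linear in the squared seminorm, so that of `A` is the sum of the nonnegative
defects of the `q i` and dominates each. -/
theorem tendsto_convexityDefect_of_tsum {q : ℕ → Seminorm ℝ X} {A : Seminorm ℝ X}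
    (hs : ∀ x, Summable fun n => q n x ^ 2) (hA : ∀ x, A x = √(∑' n, q n x ^ 2)) {u v : ℕ → X}
    (h : Tendsto (fun n => convexityDefect A (u n) (v n)) atTop (𝓝 0)) (k : ℕ) :
    Tendsto (fun n => convexityDefect (q k) (u n) (v n)) atTop (𝓝 0) := by
  refine squeeze_zero (fun n => convexityDefect_nonneg _ _ _) (fun n => ?_) h
  have hsq : ∀ x, A x ^ 2 = ∑' n, q n x ^ 2 := fun x => by
    rw [hA, Real.sq_sqrt (tsum_nonneg fun n => sq_nonneg _)]
  have hsum : HasSum (fun i => convexityDefect (q i) (u n) (v n))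
      (convexityDefect A (u n) (v n)) := by
    simp only [convexityDefect, hsq]
    exact (((hs _).hasSum.mul_left 2).add ((hs _).hasSum.mul_left 2)).sub (hs _).hasSum
  exact le_hasSum hsum k fun i _ => convexityDefect_nonneg _ _ _

/-- A lower semicontinuous equivalent norm can be changed so that its convexity defect controls
those of countably many given support functions. -/
theorem exists_norm_controlling_supportFun {F : Submodule ℝ (StrongDual ℝ X)} {p : Seminorm ℝ X}
    (hp : IsEquivalentNorm p) (hlsc : IsSigmaLSC F p) (G : ℕ → Set (StrongDual ℝ X))
    (hGF : ∀ n, G n ⊆ F) (hG : ∀ n, ∀ g ∈ G n, ‖g‖ ≤ 1) (h0 : ∀ n, (0 : StrongDual ℝ X) ∈ G n) :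
    ∃ A : Seminorm ℝ X, IsEquivalentNorm A ∧ IsSigmaLSC F A ∧ ∀ u v : ℕ → X,
      Tendsto (fun n => convexityDefect A (u n) (v n)) atTop (𝓝 0) →
      Tendsto (fun n => convexityDefect p (u n) (v n)) atTop (𝓝 0) ∧
      ∀ k, Tendsto (fun n => 2 * supportFun (G k) (u n) ^ 2 + 2 * supportFun (G k) (v n) ^ 2
        - supportFun (G k) (u n + v n) ^ 2) atTop (𝓝 0) := by
  obtain ⟨c, C, hc, hC, hpc⟩ := hp
  choose q hq using fun n => exists_seminorm_sq_eq_supportFun (hG n) (h0 n)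
  have hq_sq : ∀ n x, q n x ^ 2 = supportFun (G n) x ^ 2 + supportFun (G n) (-x) ^ 2 := fun n x => by
    rw [hq, Real.sq_sqrt (by positivity)]
  have hq_le : ∀ n x, q n x ^ 2 ≤ 2 * ‖x‖ ^ 2 := fun n x => by
    rw [hq_sq]
    have h1 := pow_le_pow_left₀ (supportFun_nonneg (hG n) (h0 n) x)
      (supportFun_le_norm (hG n) (h0 n) x) 2
    have h2 := pow_le_pow_left₀ (supportFun_nonneg (hG n) (h0 n) (-x))
      (supportFun_le_norm (hG n) (h0 n) (-x)) 2
    rw [norm_neg] at h2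
    linarith
  have hq_lsc : ∀ n, IsSigmaLSC F (q n) := fun n => by
    have h1 := @LowerSemicontinuous.sq_of_nonneg X (sigmaTopology F) _
      (lowerSemicontinuous_supportFun (hG n) (hGF n)) (supportFun_nonneg (hG n) (h0 n))
    have h2 := @LowerSemicontinuous.sq_of_nonneg X (sigmaTopology F) _
      (lowerSemicontinuous_supportFun_neg (hG n) (hGF n))
      (fun x => supportFun_nonneg (hG n) (h0 n) (-x))
    have h4 : (fun x => q n x) =
        fun x => √(supportFun (G n) x ^ 2 + supportFun (G n) (-x) ^ 2) := funext (hq n)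
    unfold IsSigmaLSC
    rw [h4]
    exact @LowerSemicontinuous.sqrt_add X (sigmaTopology F) _ _ h1 h2
  let w : ℕ → NNReal := fun n => (1 / 2) ^ n
  -- Slot `0` holds `p`, which gives the lower norm bound and control of the defect of `p`; the `q
  -- n` sit one place later, with squared weights `4⁻ⁿ`.
  let N : ℕ → Seminorm ℝ X := fun n => Nat.casesOn n p fun n => w n • q n
  have hN_sq : ∀ n x, N (n + 1) x ^ 2 = (1 / 4) ^ n * q n x ^ 2 := fun n x => by
    change (((1 / 2 : NNReal) ^ n • q n) x) ^ 2 = _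
    rw [_root_.smul_apply, NNReal.smul_def, smul_eq_mul, mul_pow, NNReal.coe_pow, ← pow_mul,
      mul_comm n 2, pow_mul]
    norm_num
  have hNb : ∀ n x, N (n + 1) x ^ 2 ≤ (1 / 4) ^ n * (2 * ‖x‖ ^ 2) := fun n x => by
    rw [hN_sq]
    exact mul_le_mul_of_nonneg_left (hq_le n x) (by positivity)
  have hgeo : Summable fun n : ℕ => ((1 : ℝ) / 4) ^ n :=
    summable_geometric_of_lt_one (by norm_num) (by norm_num)
  have hs' : ∀ x, Summable fun n => N (n + 1) x ^ 2 := fun x =>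
    Summable.of_nonneg_of_le (fun n => sq_nonneg _) (fun n => hNb n x) (hgeo.mul_right _)
  have hs : ∀ x, Summable fun n => N n x ^ 2 := fun x => (summable_nat_add_iff 1).1 (hs' x)
  obtain ⟨A, hA⟩ := exists_seminorm_sq_eq_tsum N hs
  refine ⟨A, ?_, ?_, fun u v h => ⟨tendsto_convexityDefect_of_tsum hs hA h 0, fun k => ?_⟩⟩
  · refine ⟨c, √(C ^ 2 + 4), hc, by positivity, fun x => ⟨(hpc x).1.trans ?_, ?_⟩⟩
    · change p x ≤ A x
      rw [hA]
      exact Real.le_sqrt_of_sq_le ((hs x).le_tsum 0 fun n _ => sq_nonneg _)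
    · change A x ≤ _
      rw [hA, ← Real.sqrt_sq (norm_nonneg x), ← Real.sqrt_mul (by positivity)]
      refine Real.sqrt_le_sqrt ?_
      rw [(hs x).tsum_eq_zero_add]
      have h1 : N 0 x ^ 2 ≤ C ^ 2 * ‖x‖ ^ 2 := by
        rw [← mul_pow]; exact pow_le_pow_left₀ (apply_nonneg _ _) (hpc x).2 2
      have h2 : ∑' n, N (n + 1) x ^ 2 ≤ (4 / 3) * (2 * ‖x‖ ^ 2) := by
        refine ((hs' x).tsum_le_tsum (fun n => hNb n x) (hgeo.mul_right _)).trans ?_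
        rw [tsum_mul_right, tsum_geometric_of_lt_one (by norm_num) (by norm_num)]
        norm_num
      nlinarith [sq_nonneg ‖x‖]
  · unfold IsSigmaLSC
    have hAe : (fun x => A x) = fun x => √(∑' n, N n x ^ 2) := funext hA
    rw [hAe]
    refine @LowerSemicontinuous.sqrt_tsum_sq X (sigmaTopology F) _ (fun n => ?_)
      (fun n x => apply_nonneg _ _) hs
    cases n with
    | zero => exact hlsc
    | succ n =>
      exact @LowerSemicontinuous.nonneg_mul X (sigmaTopology F) _ (hq_lsc n) _ (w n).2
  · have hk := (tendsto_convexityDefect_of_tsum hs hA h (k + 1)).const_mul ((4 : ℝ) ^ k)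
    rw [mul_zero] at hk
    have hpos : ∀ a b : X, 0 ≤ 2 * supportFun (G k) a ^ 2 + 2 * supportFun (G k) b ^ 2
        - supportFun (G k) (a + b) ^ 2 := fun a b =>
      (sq_nonneg _).trans (sq_sub_le_of_add_le (supportFun_nonneg (hG k) (h0 k) _)
        (supportFun_add_le (hG k) (h0 k) a b))
    refine squeeze_zero (fun n => hpos _ _) (fun n => ?_) hk
    have h41 : (4 : ℝ) ^ k * (1 / 4) ^ k = 1 := by rw [← mul_pow]; norm_num
    have hdef : 4 ^ k * convexityDefect (N (k + 1)) (u n) (v n) =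
        convexityDefect (q k) (u n) (v n) := by
      simp only [convexityDefect, hN_sq]
      linear_combination (2 * q k (u n) ^ 2 + 2 * q k (v n) ^ 2 - q k (u n + v n) ^ 2) * h41
    -- The defect of the reflected support function is nonnegative and can be dropped.
    rw [hdef, convexityDefect, hq_sq, hq_sq, hq_sq, neg_add]
    linarith [hpos (-u n) (-v n)]

end Renorming

/-! ### From denting points to a rotund norm. -/

namespace Renorming

theorem lt_of_diam_lt {X : Type*} {ρ : X → X → ℝ} {S : Set X} {ε : ℝ} (hε : 0 < ε)
    (h : diam ρ S < ENNReal.ofReal ε) {y z : X} (hy : y ∈ S) (hz : z ∈ S) : ρ y z < ε := by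
  have h1 : ENNReal.ofReal (ρ y z) ≤ diam ρ S :=
    le_iSup₂_of_le y hy (le_iSup₂_of_le z hz le_rfl)
  exact (ENNReal.ofReal_lt_ofReal_iff hε).1 (h1.trans_lt h)

variable {X : Type*} [NormedAddCommGroup X] [NormedSpace ℝ X]

theorem tendsto_nhds_sigma {α : Type*} {F : Submodule ℝ (StrongDual ℝ X)} {l : Filter α}
    {u : α → X} {x : X} :
    Tendsto u l (@nhds X (sigmaTopology F) x) ↔
      ∀ f ∈ F, Tendsto (fun n => f (u n)) l (𝓝 (f x)) := by
  rw [nhds_iInf, tendsto_iInf]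
  simp only [nhds_induced, tendsto_comap_iff, Subtype.forall]
  rfl

theorem tendsto_sub_of_defect {a b c : ℕ → ℝ} (hc : ∀ n, 0 ≤ c n) (h : ∀ n, c n ≤ a n + b n)
    (hD : Tendsto (fun n => 2 * a n ^ 2 + 2 * b n ^ 2 - c n ^ 2) atTop (𝓝 0)) :
    Tendsto (fun n => a n - b n) atTop (𝓝 0) := by
  have h2 : Tendsto (fun n => (a n - b n) ^ 2) atTop (𝓝 0) :=
    squeeze_zero (fun n => sq_nonneg _) (fun n => sq_sub_le_of_add_le (hc n) (h n)) hD
  have h3 := (Real.continuous_sqrt.tendsto 0).comp h2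
  simp only [Function.comp_def, Real.sqrt_sq_eq_abs, Real.sqrt_zero] at h3
  exact (tendsto_zero_iff_abs_tendsto_zero _).2 h3

theorem tendsto_of_defect {a b c : ℕ → ℝ} {L : ℝ} (hc : ∀ n, 0 ≤ c n)
    (h : ∀ n, c n ≤ a n + b n)
    (hD : Tendsto (fun n => 2 * a n ^ 2 + 2 * b n ^ 2 - c n ^ 2) atTop (𝓝 0))
    (ha : Tendsto a atTop (𝓝 L)) : Tendsto b atTop (𝓝 L) := by
  simpa using ha.sub (tendsto_sub_of_defect hc h hD)

theorem tendsto_seminorm_of_defect (p : Seminorm ℝ X) {u v : ℕ → X} {L : ℝ}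
    (hD : Tendsto (fun n => convexityDefect p (u n) (v n)) atTop (𝓝 0))
    (hu : Tendsto (fun n => p (u n)) atTop (𝓝 L)) : Tendsto (fun n => p (v n)) atTop (𝓝 L) :=
  tendsto_of_defect (fun _ => apply_nonneg p _) (fun n => map_add_le_add p (u n) (v n)) hD hu

/-- A vanishing defect sends the support function at `u n + v n` to `2 * L`. A `g` nearly attaining
it there must be nearly `L` at both summands, since neither value can go much above `L`. -/
theorem eventually_exists_common_functional {G : Set (StrongDual ℝ X)} (hG : ∀ g ∈ G, ‖g‖ ≤ 1)
    (h0 : (0 : StrongDual ℝ X) ∈ G) {u v : ℕ → X} {L r : ℝ} (hr : r < L)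
    (hu : Tendsto (fun n => supportFun G (u n)) atTop (𝓝 L))
    (hD : Tendsto (fun n => 2 * supportFun G (u n) ^ 2 + 2 * supportFun G (v n) ^ 2
        - supportFun G (u n + v n) ^ 2) atTop (𝓝 0)) :
    Tendsto (fun n => supportFun G (v n)) atTop (𝓝 L) ∧
      ∀ᶠ n in atTop, ∃ g ∈ G, r < g (u n) ∧ r < g (v n) := by
  have hv : Tendsto (fun n => supportFun G (v n)) atTop (𝓝 L) :=
    tendsto_of_defect (fun n => supportFun_nonneg hG h0 _)
      (fun n => supportFun_add_le hG h0 (u n) (v n)) hD hu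
  have hL : 0 ≤ L := ge_of_tendsto' hu fun n => supportFun_nonneg hG h0 _
  have hw : Tendsto (fun n => supportFun G (u n + v n)) atTop (𝓝 (2 * L)) := by
    have h2 := (((hu.pow 2).const_mul 2).add ((hv.pow 2).const_mul 2)).sub hD
    have h3 := (Real.continuous_sqrt.tendsto _).comp h2
    have e : √(2 * L ^ 2 + 2 * L ^ 2 - 0) = 2 * L := by
      rw [show 2 * L ^ 2 + 2 * L ^ 2 - 0 = (2 * L) ^ 2 by ring, Real.sqrt_sq (by positivity)]
    rw [e] at h3
    refine h3.congr fun n => ?_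
    simp only [Function.comp_def, sub_sub_cancel]
    exact Real.sqrt_sq (supportFun_nonneg hG h0 _)
  refine ⟨hv, ?_⟩
  have h1 : ∀ᶠ n in atTop, r < supportFun G (u n + v n) - supportFun G (u n) :=
    (hw.sub hu).eventually (lt_mem_nhds (by linarith))
  have h2 : ∀ᶠ n in atTop, r < supportFun G (u n + v n) - supportFun G (v n) :=
    (hw.sub hv).eventually (lt_mem_nhds (by linarith))
  filter_upwards [h1, h2] with n h1 h2
  obtain ⟨g, hg, hlt⟩ := exists_lt_of_lt_supportFun h0
    (max_lt (lt_sub_iff_add_lt.1 h1) (lt_sub_iff_add_lt.1 h2))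
  have e1 := le_supportFun hG hg (u n)
  have e2 := le_supportFun hG hg (v n)
  rw [map_add, max_lt_iff] at hlt
  exact ⟨g, hg, by linarith, by linarith⟩

/-- Functionals of `F` in the dual unit ball whose slices of height `1 / (k + 1)` of the unit ball
of `p` are `ρ`-small. -/
def smallSliceFunctionals (F : Submodule ℝ (StrongDual ℝ X)) (p : Seminorm ℝ X) (ρ : X → X → ℝ)
    (m k : ℕ) : Set (StrongDual ℝ X) :=
  {g | g ∈ F ∧ ‖g‖ ≤ 1 ∧ ∀ y z, p y ≤ 1 → p z ≤ 1 → 1 / ((k : ℝ) + 1) < g y →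
    1 / ((k : ℝ) + 1) < g z → ρ y z ≤ 1 / ((m : ℝ) + 1)}

theorem zero_mem_smallSliceFunctionals (F : Submodule ℝ (StrongDual ℝ X)) (p : Seminorm ℝ X)
    (ρ : X → X → ℝ) (m k : ℕ) : 0 ∈ smallSliceFunctionals F p ρ m k := by
  refine ⟨F.zero_mem, by simp, fun y z _ _ h _ => absurd h (not_lt.2 ?_)⟩
  rw [zero_apply]
  positivity

theorem exists_lt_supportFun_smallSliceFunctionals {F : Submodule ℝ (StrongDual ℝ X)}
    {p : Seminorm ℝ X} (d : MetricSpace X) {x : X} (hx : p x = 1)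
    (hd : IsDentingPoint F p (fun y z => d.dist y z) x) (m : ℕ) :
    ∃ k : ℕ, 1 / ((k : ℝ) + 1) <
      supportFun (smallSliceFunctionals F p (fun y z => d.dist y z) m k) x := by
  have hx0 : x ≠ 0 := by
    rintro rfl
    simp at hx
  have hdx : 0 < d.dist x 0 := (@dist_pos X d x 0).2 hx0
  have hm : (0 : ℝ) < 1 / ((m : ℝ) + 1) := by positivity
  -- Keeping the diameter below `d(x, 0)` excludes `0` from the slice, so its level `a` is
  -- nonnegative.
  have hε := lt_min hm hdx
  obtain ⟨H, ⟨f, hfF, hf0, a, rfl⟩, hax, hdiam⟩ := hd _ hε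
  have hax : a < f x := hax
  have ha : 0 ≤ a := by
    by_contra hneg
    have h := lt_of_diam_lt hε hdiam (y := x) (z := 0) ⟨hax, hx.le⟩
      ⟨by simpa using hneg, by simp⟩
    exact lt_irrefl _ (h.trans_le (min_le_right _ _))
  obtain ⟨b, hab, hbx⟩ := exists_between hax
  have hb : 0 < b := ha.trans_lt hab
  have hfn : 0 < ‖f‖ := norm_pos_iff.2 hf0
  -- Rescaling `f` moves the level `b` to `1 / (k + 1)`; `k` is large enough for the rescaled
  -- functional to have norm at most `1`.
  obtain ⟨k, hk⟩ := exists_nat_one_div_lt (show 0 < b / ‖f‖ by positivity)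
  have hk0 : (0 : ℝ) < 1 / ((k : ℝ) + 1) := by positivity
  set t : ℝ := 1 / ((k : ℝ) + 1)
  have hscale : ∀ y, t < (t / b) * f y ↔ b < f y := fun y => by
    rw [div_mul_eq_mul_div, lt_div_iff₀ hb, mul_lt_mul_iff_right₀ hk0]
  suffices hmem : (t / b) • f ∈ smallSliceFunctionals F p (fun y z => d.dist y z) m k from
    ⟨k, lt_of_lt_of_le ((hscale x).2 hbx) (le_supportFun (fun g hg => hg.2.1) hmem x)⟩
  refine ⟨F.smul_mem _ hfF, ?_, ?_⟩
  · rw [norm_smul, Real.norm_of_nonneg (by positivity), div_mul_eq_mul_div, div_le_one hb]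
    exact ((lt_div_iff₀ hfn).1 hk).le
  · intro y z hy hz hgy hgz
    have h := lt_of_diam_lt hε hdiam (y := y) (z := z)
      ⟨hab.trans ((hscale y).1 hgy), hy⟩ ⟨hab.trans ((hscale z).1 hgz), hz⟩
    exact (h.trans_le (min_le_left _ _)).le

theorem IsEquivalentNorm.pos {p : Seminorm ℝ X} (hp : IsEquivalentNorm p) {x : X} (hx : x ≠ 0) :
    0 < p x := by
  obtain ⟨c, C, hc, -, h⟩ := hp
  exact (mul_pos hc (norm_pos_iff.2 hx)).trans_le (h x).1

theorem seminorm_inv_smul_self {p : Seminorm ℝ X} {x : X} (hx : 0 < p x) :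
    p ((p x)⁻¹ • x) = 1 := by
  rw [map_smul_eq_mul, Real.norm_of_nonneg (inv_nonneg.2 hx.le), inv_mul_cancel₀ hx.ne']

theorem exists_norm_of_denting {F : Submodule ℝ (StrongDual ℝ X)} {p : Seminorm ℝ X}
    (hp : IsEquivalentNorm p) (hlsc : IsSigmaLSC F p) (d : MetricSpace X)
    (hdF : d.toPseudoMetricSpace.toUniformSpace.toTopologicalSpace ≤ sigmaTopology F)
    (hd : ∀ x : X, p x = 1 → IsDentingPoint F p (fun y z => d.dist y z) x) :
    ∃ p : Seminorm ℝ X, IsEquivalentNorm p ∧ IsSigmaLSC F p ∧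
      ∀ (x : X) (u v : ℕ → X),
        Tendsto (fun n => convexityDefect p (u n) (v n)) atTop (𝓝 0) →
        Tendsto (fun n => convexityDefect p x (u n)) atTop (𝓝 0) →
        Tendsto v atTop (@nhds X (sigmaTopology F) x) := by
  let G : ℕ → ℕ → Set (StrongDual ℝ X) := smallSliceFunctionals F p fun y z => d.dist y z
  have hG : ∀ m k, ∀ g ∈ G m k, ‖g‖ ≤ 1 := fun m k g hg => hg.2.1
  have h0 : ∀ m k, (0 : StrongDual ℝ X) ∈ G m k := zero_mem_smallSliceFunctionals F p _
  obtain ⟨A, hA, hAlsc, hAQ⟩ := exists_norm_controlling_supportFun hp hlsc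
    (fun n => G n.unpair.1 n.unpair.2) (fun n g hg => hg.1) (fun n => hG _ _) (fun n => h0 _ _)
  refine ⟨A, hA, hAlsc, fun x u v huv hxu => ?_⟩
  obtain ⟨hpuv, hGuv⟩ := hAQ u v huv
  obtain ⟨hpxu, hGxu⟩ := hAQ (fun _ => x) u hxu
  have hpu := tendsto_seminorm_of_defect p hpxu tendsto_const_nhds
  have hpv := tendsto_seminorm_of_defect p hpuv hpu
  have hpv_smul : ∀ n, p (v n) • (p (v n))⁻¹ • v n = v n := fun n => by
    rcases eq_or_ne (v n) 0 with h | h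
    · simp [h]
    · exact smul_inv_smul₀ (hp.pos h).ne' _
  rcases eq_or_ne x 0 with rfl | hx
  · obtain ⟨c, C, hc, -, hcp⟩ := hp
    rw [map_zero] at hpv
    have hv0 : Tendsto v atTop (𝓝 0) := by
      rw [tendsto_zero_iff_norm_tendsto_zero]
      refine squeeze_zero (fun n => norm_nonneg _) (fun n => ?_) (by simpa using hpv.const_mul c⁻¹)
      rw [le_inv_mul_iff₀ hc]
      exact (hcp (v n)).1
    exact tendsto_nhds_sigma.2 fun f _ => (f.continuous.tendsto 0).comp hv0
  have ht := hp.pos hx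
  set t := p x with ht_def
  have hclose : ∀ m : ℕ, ∀ᶠ n in atTop,
      d.dist ((p (v n))⁻¹ • v n) (t⁻¹ • x) ≤ 2 * (1 / ((m : ℝ) + 1)) := by
    intro m
    have hx1 : p (t⁻¹ • x) = 1 := seminorm_inv_smul_self ht
    obtain ⟨k, hk⟩ := exists_lt_supportFun_smallSliceFunctionals d hx1 (hd _ hx1) m
    have hk' : t * (1 / ((k : ℝ) + 1)) < supportFun (G m k) x := by
      rw [supportFun_smul (inv_nonneg.2 ht.le), lt_inv_mul_iff₀ ht] at hk
      exact hk
    -- The gap between `t / (k + 1)` and `r` absorbs the differences of `p (u n)` and `p (v n)` from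
    -- `t` when the vectors are normalized.
    obtain ⟨r, hr1, hr2⟩ := exists_between hk'
    have e1 := hGuv (Nat.pair m k)
    have e2 := hGxu (Nat.pair m k)
    simp only [Nat.unpair_pair] at e1 e2
    obtain ⟨hsu, hg1⟩ := eventually_exists_common_functional (hG m k) (h0 m k) hr2
      tendsto_const_nhds e2
    obtain ⟨-, hg2⟩ := eventually_exists_common_functional (hG m k) (h0 m k) hr2 hsu e1
    have hscale : ∀ {g : StrongDual ℝ X} {y : X}, 0 < p y → p y * (1 / ((k : ℝ) + 1)) < r →
        r < g y → 1 / ((k : ℝ) + 1) < g ((p y)⁻¹ • y) := fun {g y} h1 h2 h3 => by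
      rw [map_smul, smul_eq_mul, lt_inv_mul_iff₀ h1]
      exact h2.trans h3
    filter_upwards [hg1, hg2, hpu.eventually (lt_mem_nhds ht), hpv.eventually (lt_mem_nhds ht),
      (hpu.mul_const _).eventually (gt_mem_nhds hr1),
      (hpv.mul_const _).eventually (gt_mem_nhds hr1)] with n hg1 hg2 hu0 hv0 hur hvr
    obtain ⟨g, hg, hgx, hgu⟩ := hg1
    obtain ⟨g', hg', hgu', hgv'⟩ := hg2
    have d1 := hg.2.2 _ _ (seminorm_inv_smul_self hu0).le hx1.le (hscale hu0 hur hgu)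
      (hscale ht hr1 hgx)
    have d2 := hg'.2.2 _ _ (seminorm_inv_smul_self hv0).le (seminorm_inv_smul_self hu0).le
      (hscale hv0 hvr hgv') (hscale hu0 hur hgu')
    have tri := @dist_triangle X d.toPseudoMetricSpace ((p (v n))⁻¹ • v n) ((p (u n))⁻¹ • u n)
      (t⁻¹ • x)
    exact tri.trans (by linarith [d1, d2])
  have hlim : Tendsto (fun n => (p (v n))⁻¹ • v n) atTop
      (@nhds X d.toPseudoMetricSpace.toUniformSpace.toTopologicalSpace (t⁻¹ • x)) := by
    refine (@Metric.tendsto_nhds X ℕ d.toPseudoMetricSpace _ _ _).2 fun ε hε => ?_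
    obtain ⟨m, hm⟩ := exists_nat_one_div_lt (half_pos hε)
    filter_upwards [hclose m] with n hn
    exact lt_of_le_of_lt hn (by linarith)
  have hlim' := tendsto_nhds_sigma.1 (hlim.mono_right (nhds_mono hdF))
  refine tendsto_nhds_sigma.2 fun f hf => ?_
  have h := hpv.mul (hlim' f hf)
  simp only [← smul_eq_mul, ← map_smul] at h
  rw [smul_inv_smul₀ ht.ne'] at h
  simpa only [hpv_smul] using h

end Renorming

/-! ### Hahn–Banach separation and slices by functionals of `F`. -/

theorem exists_mem_span_separating {E ι : Type*} [AddCommGroup E] [Module ℝ E]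
    (φ : ι → E →ₗ[ℝ] ℝ) {s : Set E} (hs : Convex ℝ s)
    (hcl : @IsClosed E (⨅ i, TopologicalSpace.induced (φ i) inferInstance) s) {x : E}
    (hx : x ∉ s) :
    ∃ g ∈ Submodule.span ℝ (Set.range φ), ∃ u : ℝ, (∀ a ∈ s, g a < u) ∧ u < g x := by
  let _ : TopologicalSpace E := ⨅ i, TopologicalSpace.induced (φ i) inferInstance
  have : IsTopologicalAddGroup E := topologicalAddGroup_iInf fun _ => topologicalAddGroup_induced _
  have : ContinuousSMul ℝ E := continuousSMul_iInf fun _ => continuousSMul_induced _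
  have : LocallyConvexSpace ℝ E := LocallyConvexSpace.iInf fun _ => LocallyConvexSpace.induced _
  obtain ⟨g, u, hg, hgx⟩ := geometric_hahn_banach_closed_point hs hcl hx
  exact ⟨g.toLinearMap, (LinearMap.mem_span_iff_continuous _).2 g.continuous, u, hg, hgx⟩

namespace Renorming

variable {X : Type*} [NormedAddCommGroup X] [NormedSpace ℝ X]
  {F : Submodule ℝ (StrongDual ℝ X)} {p : Seminorm ℝ X}

/-- Lower semicontinuity makes the unit ball of `p` `σ(X, F)`-closed, so a multiple of `x` just
outside it is separated from it by a member of `F`. -/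
theorem exists_functional_le_seminorm (hlsc : IsSigmaLSC F p) {x : X} (hx : p x = 1) {r : ℝ}
    (hr : r < 1) : ∃ f ∈ F, (∀ y, f y ≤ p y) ∧ r < f x := by
  obtain ⟨c, hrc, hc1⟩ := exists_between (max_lt hr one_pos)
  have hc0 : 0 < c := (le_max_right _ _).trans_lt hrc
  have hconv : Convex ℝ {y | p y ≤ 1} := by
    simpa [Seminorm.closedBall_zero_eq] using p.convex_closedBall 0 1
  have hcl : @IsClosed X (sigmaTopology F) {y | p y ≤ 1} :=
    @LowerSemicontinuous.isClosed_preimage X (sigmaTopology F) _ _ _ hlsc 1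
  have hxn : c⁻¹ • x ∉ {y | p y ≤ 1} := by
    change ¬ p (c⁻¹ • x) ≤ 1
    rw [map_smul_eq_mul, hx, mul_one, Real.norm_of_nonneg (by positivity), not_le]
    exact (one_lt_inv₀ hc0).2 hc1
  obtain ⟨g, hg, u, hgu, hgx⟩ := exists_mem_span_separating
    (fun f : F => ((f : StrongDual ℝ X) : X →ₗ[ℝ] ℝ)) hconv hcl hxn
  have hgF : g ∈ F.map (ContinuousLinearMap.coeLM ℝ) := by
    refine Submodule.span_le.2 ?_ hg
    rintro _ ⟨f, rfl⟩
    exact ⟨f, f.2, rfl⟩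
  obtain ⟨f, hf, rfl⟩ := hgF
  have hu : 0 < u := by simpa using hgu 0 (by simp)
  have hgx' : u < c⁻¹ * f x := by simpa using hgx
  refine ⟨u⁻¹ • f, F.smul_mem _ hf, fun y => ?_, ?_⟩
  · change u⁻¹ * f y ≤ p y
    rw [inv_mul_le_iff₀ hu]
    -- The slack `ε / u` allows division where `p y = 0`.
    refine le_of_forall_pos_le_add fun ε hε => ?_
    have hδ : 0 < p y + ε / u := by have := apply_nonneg p y; positivity
    have h := hgu ((p y + ε / u)⁻¹ • y) (by
      change p _ ≤ 1
      rw [map_smul_eq_mul, Real.norm_of_nonneg (by positivity), inv_mul_le_iff₀ hδ, mul_one]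
      linarith [div_pos hε hu])
    have h' : (p y + ε / u)⁻¹ * f y < u := by simpa using h
    rw [inv_mul_lt_iff₀ hδ, add_mul, div_mul_cancel₀ _ hu.ne'] at h'
    linarith
  · change r < u⁻¹ * f x
    rw [lt_inv_mul_iff₀ hc0] at hgx'
    rw [lt_inv_mul_iff₀ hu]
    nlinarith [le_max_left r 0]

theorem convexityDefect_le_of_functional {f : StrongDual ℝ X} (hf : ∀ y, f y ≤ p y) {r : ℝ}
    (hr : 0 ≤ r) {x y : X} (hx : p x ≤ 1) (hy : p y ≤ 1) (hfx : r ≤ f x) (hfy : r ≤ f y) :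
    convexityDefect p x y ≤ 4 - 4 * r ^ 2 := by
  have h1 : 2 * r ≤ p (x + y) := by
    have := hf (x + y)
    rw [map_add] at this
    linarith
  have h2 := pow_le_pow_left₀ (by positivity) h1 2
  have h3 := pow_le_pow_left₀ (apply_nonneg p x) hx 2
  have h4 := pow_le_pow_left₀ (apply_nonneg p y) hy 2
  unfold convexityDefect
  linarith

/-- The heights of the slices used to compare points of the unit sphere. -/
noncomputable def sliceHeight (n : ℕ) : ℝ := 1 - 1 / ((n : ℝ) + 1)

theorem sliceHeight_lt_one (n : ℕ) : sliceHeight n < 1 := by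
  have : (0 : ℝ) < 1 / ((n : ℝ) + 1) := by positivity
  unfold sliceHeight
  linarith

theorem sliceHeight_nonneg (n : ℕ) : 0 ≤ sliceHeight n :=
  sub_nonneg.2 ((div_le_one (by positivity)).2 (by linarith [n.cast_nonneg (α := ℝ)]))

theorem sliceHeight_mono : Monotone sliceHeight := fun _ _ h =>
  sub_le_sub_left (Nat.one_div_le_one_div h) 1

theorem tendsto_sliceHeight : Tendsto (fun n => 4 - 4 * sliceHeight n ^ 2) atTop (𝓝 0) := by
  have h : Tendsto sliceHeight atTop (𝓝 (1 - 0)) :=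
    tendsto_const_nhds.sub tendsto_one_div_add_atTop_nhds_zero_nat
  simpa using ((h.pow 2).const_mul 4).const_sub 4

theorem tendsto_convexityDefect_of_functionals {f : ℕ → StrongDual ℝ X}
    (hf : ∀ n y, f n y ≤ p y) {u v : ℕ → X} (hu : ∀ n, p (u n) ≤ 1) (hv : ∀ n, p (v n) ≤ 1)
    (hfu : ∀ n, sliceHeight n < f n (u n)) (hfv : ∀ n, sliceHeight n < f n (v n)) :
    Tendsto (fun n => convexityDefect p (u n) (v n)) atTop (𝓝 0) :=
  squeeze_zero (fun _ => convexityDefect_nonneg _ _ _)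
    (fun n => convexityDefect_le_of_functional (hf n) (sliceHeight_nonneg n) (hu n) (hv n)
      (hfu n).le (hfv n).le) tendsto_sliceHeight

/-! ### Metrizability of the unit sphere. -/

/-- Two points of the unit sphere of `p` lie in a common slice of height `sliceHeight n`. -/
def InCommonSlice (F : Submodule ℝ (StrongDual ℝ X)) (p : Seminorm ℝ X) (n : ℕ)
    (x y : {x : X // p x = 1}) : Prop :=
  ∃ f ∈ F, (∀ z, f z ≤ p z) ∧ sliceHeight n < f x ∧ sliceHeight n < f y

/-- The topology `σ(X, F)` on the unit sphere of `p`. -/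
abbrev sphereTopology (F : Submodule ℝ (StrongDual ℝ X)) (p : Seminorm ℝ X) :
    TopologicalSpace {x : X // p x = 1} :=
  TopologicalSpace.induced Subtype.val (sigmaTopology F)

theorem continuous_sphere {f : StrongDual ℝ X} (hf : f ∈ F) :
    @Continuous {x : X // p x = 1} ℝ (sphereTopology F p) _ fun z => f z :=
  @Continuous.comp _ _ _ (sphereTopology F p) (sigmaTopology F) _ _ _ (continuous_sigma hf)
    (@continuous_induced_dom _ _ _ (sigmaTopology F))

theorem tendsto_nhds_sphere {α : Type*} {l : Filter α} {u : α → {x : X // p x = 1}}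
    {x : {x : X // p x = 1}} :
    Tendsto u l (@nhds _ (sphereTopology F p) x) ↔
      Tendsto (fun n => (u n : X)) l (@nhds X (sigmaTopology F) x) := by
  rw [@nhds_induced _ _ (sigmaTopology F), tendsto_comap_iff]
  rfl

/-- The two-step local uniform rotundity of `p` with respect to `σ(X, F)`. -/
def IsTwoStepRotund (F : Submodule ℝ (StrongDual ℝ X)) (p : Seminorm ℝ X) : Prop :=
  ∀ (x : X) (u v : ℕ → X),
    Tendsto (fun n => convexityDefect p (u n) (v n)) atTop (𝓝 0) →
    Tendsto (fun n => convexityDefect p x (u n)) atTop (𝓝 0) →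
    Tendsto v atTop (@nhds X (sigmaTopology F) x)

/-- The two-step base condition is two-step rotundity read on the sphere: if it failed, chains `x`,
`y n`, `z n` through ever higher slices would have vanishing defects, although no `z n` lies in `U`.
-/
theorem isMooreSequence_inCommonSlice (hlsc : IsSigmaLSC F p) (h : IsTwoStepRotund F p) :
    @IsMooreSequence _ (sphereTopology F p) (InCommonSlice F p) := by
  refine @IsMooreSequence.mk _ (sphereTopology F p) _ ?_ ?_ ?_ ?_ ?_
  · intro n x
    obtain ⟨f, hf, hfp, hfx⟩ := exists_functional_le_seminorm hlsc x.2 (sliceHeight_lt_one n)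
    exact ⟨f, hf, hfp, hfx, hfx⟩
  · rintro n x y ⟨f, hf, hfp, hfx, hfy⟩
    exact ⟨f, hf, hfp, hfy, hfx⟩
  · rintro m n hmn x y ⟨f, hf, hfp, hfx, hfy⟩
    exact ⟨f, hf, hfp, (sliceHeight_mono hmn).trans_lt hfx, (sliceHeight_mono hmn).trans_lt hfy⟩
  · intro n x
    refine (@isOpen_iff_mem_nhds _ (sphereTopology F p) _).2 ?_
    rintro y ⟨f, hf, hfp, hfx, hfy⟩
    filter_upwards [(@Continuous.tendsto _ _ (sphereTopology F p) _ _ (continuous_sphere hf) y).eventually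
      (lt_mem_nhds hfy)] with z hz
    exact ⟨f, hf, hfp, hfx, hz⟩
  · intro x U hU
    by_contra! hcon
    choose y z hxy hyz hz using hcon
    choose f hf hfp hfx hfy using hxy
    choose g hg hgp hgy hgz using hyz
    have hlim := h x (fun n => y n) (fun n => z n)
      (tendsto_convexityDefect_of_functionals hgp (fun n => (y n).2.le) (fun n => (z n).2.le)
        hgy hgz)
      (tendsto_convexityDefect_of_functionals (u := fun _ => x) hfp (fun _ => x.2.le)
        (fun n => (y n).2.le) hfx hfy)
    obtain ⟨n, hn⟩ := ((tendsto_nhds_sphere.2 hlim).eventually hU).exists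
    exact hz n hn

theorem IsNorming.eq_zero (hF : IsNorming F) {x : X} (hx : ∀ f ∈ F, f x = 0) : x = 0 := by
  obtain ⟨c, C, hc, -, h⟩ := hF
  have hset : {r : ℝ | ∃ f ∈ F, ‖f‖ ≤ 1 ∧ r = |f x|} ⊆ {0} := by
    rintro _ ⟨f, hf, -, rfl⟩
    simp [hx f hf]
  have h0 : supNorm F x ≤ 0 := Real.sSup_nonpos fun r hr => (hset hr).le
  exact norm_le_zero_iff.1 (nonpos_of_mul_nonpos_right ((h x).1.trans h0) hc)

theorem exists_metric_sphere (hF : IsNorming F) (hlsc : IsSigmaLSC F p)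
    (h : IsTwoStepRotund F p) :
    ∃ m : MetricSpace {x : X // p x = 1},
      m.toPseudoMetricSpace.toUniformSpace.toTopologicalSpace = sphereTopology F p := by
  let _ := sphereTopology F p
  have h1 := (isMooreSequence_inCommonSlice hlsc h).pseudoMetrizableSpace
  have h2 : T0Space {x : X // p x = 1} := ⟨fun x y hxy => by
    refine Subtype.ext (sub_eq_zero.1 (hF.eq_zero fun f hf => ?_))
    rw [map_sub, sub_eq_zero]
    exact (hxy.map (continuous_sphere hf)).eq⟩
  have h3 : TopologicalSpace.MetrizableSpace {x : X // p x = 1} := ⟨⟩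
  exact ⟨TopologicalSpace.metrizableSpaceMetric _, rfl⟩

/-! ### The denting metric. -/

/-- The metric pulled back along polar coordinates `x ↦ (π x, p x)`, where `π` is a retraction onto
a metrized copy `S` of the unit sphere, makes the points of the sphere denting. -/
theorem exists_denting_metric_of_polar {S : Type*} [MetricSpace S] (hp : IsEquivalentNorm p)
    (hlsc : IsSigmaLSC F p) (h : IsTwoStepRotund F p) (val : S → X) (π : X → S)
    (hπp : ∀ x, p x • val (π x) = x)
    (hval : ∀ {u : ℕ → S} {s : S},
      Tendsto u atTop (𝓝 s) ↔ Tendsto (fun n => val (u n)) atTop (@nhds X (sigmaTopology F) (val s)))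
    (hcont : ∀ f ∈ F, Continuous fun s => f (val s)) :
    ∃ d : MetricSpace X,
      d.toPseudoMetricSpace.toUniformSpace.toTopologicalSpace ≤ sigmaTopology F ∧
      ∀ x : X, p x = 1 → IsDentingPoint F p (fun y z => d.dist y z) x := by
  have hπ : ∀ x, x ≠ 0 → val (π x) = (p x)⁻¹ • x := fun x hx => by
    rw [eq_inv_smul_iff₀ (hp.pos hx).ne', hπp]
  let Φ : X → S × ℝ := fun x => (π x, p x)
  have hΦ : Function.Injective Φ := fun x y hxy => by
    have h1 : π x = π y := congrArg Prod.fst hxy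
    have h2 : p x = p y := congrArg Prod.snd hxy
    rw [← hπp x, ← hπp y, h1, h2]
  let d : MetricSpace X := MetricSpace.induced Φ hΦ inferInstance
  have hdist : ∀ x y, d.dist x y = dist (Φ x) (Φ y) := fun x y => rfl
  refine ⟨d, le_iInf fun f => ?_, fun x hx ε hε => ?_⟩
  · rw [← continuous_iff_le_induced]
    have hcomp : Continuous fun q : S × ℝ => q.2 * (f : StrongDual ℝ X) (val q.1) :=
      continuous_snd.mul ((hcont f f.2).comp continuous_fst)
    have heq : (fun x => (f : StrongDual ℝ X) x) =
        (fun q : S × ℝ => q.2 * (f : StrongDual ℝ X) (val q.1)) ∘ Φ := funext fun x => by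
      change _ = p x * (f : StrongDual ℝ X) (val (π x))
      rw [← smul_eq_mul, ← map_smul, hπp]
    rw [heq]
    exact @Continuous.comp X (S × ℝ) ℝ d.toPseudoMetricSpace.toUniformSpace.toTopologicalSpace _ _ Φ _
      hcomp (@continuous_induced_dom X (S × ℝ) Φ _)
  · choose f hf hfp hfx using fun n => exists_functional_le_seminorm hlsc hx (sliceHeight_lt_one n)
    have hxball : p x ≤ 1 := hx.le
    have key : ∃ n, ∀ y, p y ≤ 1 → sliceHeight n < f n y → d.dist y x < ε / 4 := by
      by_contra! hcon
      choose y hy hfy hdy using hcon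
      have hQ : Tendsto (fun n => convexityDefect p x (y n)) atTop (𝓝 0) :=
        tendsto_convexityDefect_of_functionals (u := fun _ => x) hfp (fun _ => hxball) hy hfx hfy
      -- Only one step is needed here, so both sequences are taken equal to `y`.
      have hyx : Tendsto y atTop (@nhds X (sigmaTopology F) x) := h x y y
        (tendsto_convexityDefect_of_functionals hfp hy hy hfy hfy) hQ
      have hpy : Tendsto (fun n => p (y n)) atTop (𝓝 (p x)) :=
        tendsto_seminorm_of_defect p hQ tendsto_const_nhds
      have hy0 : ∀ n, y n ≠ 0 := fun n h0 => by
        have := hfy n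
        rw [h0, map_zero] at this
        exact absurd this (not_lt.2 (sliceHeight_nonneg n))
      have hx0 : x ≠ 0 := by
        rintro rfl
        simp at hx
      have hπy : Tendsto (fun n => π (y n)) atTop (𝓝 (π x)) := by
        rw [hval, tendsto_nhds_sigma]
        intro g hg
        have hlim := (hpy.inv₀ (hp.pos hx0).ne').mul (tendsto_nhds_sigma.1 hyx g hg)
        simpa only [hπ _ hx0, hπ _ (hy0 _), map_smul, smul_eq_mul] using hlim
      have hΦy : Tendsto (fun n => Φ (y n)) atTop (𝓝 (Φ x)) := hπy.prodMk_nhds hpy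
      obtain ⟨n, hn⟩ := ((Metric.tendsto_nhds.1 hΦy) (ε / 4) (by positivity)).exists
      rw [← hdist] at hn
      exact absurd hn (not_lt.2 (hdy n))
    obtain ⟨n, hn⟩ := key
    refine ⟨{y | sliceHeight n < f n y}, ⟨f n, hf n, ?_, _, rfl⟩, hfx n, ?_⟩
    · rintro h0
      have := hfx n
      rw [h0, zero_apply] at this
      exact absurd this (not_lt.2 (sliceHeight_nonneg n))
    · refine lt_of_le_of_lt (b := ENNReal.ofReal (ε / 2)) ?_
        ((ENNReal.ofReal_lt_ofReal_iff hε).2 (by linarith))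
      refine iSup₂_le fun y hy => iSup₂_le fun z hz => ENNReal.ofReal_le_ofReal ?_
      have h1 := hn y hy.2 hy.1
      have h2 := hn z hz.2 hz.1
      have tri := @dist_triangle_right X d.toPseudoMetricSpace y z x
      exact tri.trans (by linarith [h1, h2])

theorem exists_denting_metric (hF : IsNorming F) (hp : IsEquivalentNorm p)
    (hlsc : IsSigmaLSC F p) (h : IsTwoStepRotund F p) :
    ∃ d : MetricSpace X,
      d.toPseudoMetricSpace.toUniformSpace.toTopologicalSpace ≤ sigmaTopology F ∧
      ∀ x : X, p x = 1 → IsDentingPoint F p (fun y z => d.dist y z) x := by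
  classical
  by_cases hne : ∃ s : X, p s = 1
  swap
  · refine ⟨inferInstance, le_iInf fun f => ?_, fun x hx => absurd ⟨x, hx⟩ hne⟩
    exact continuous_iff_le_induced.1 (f : StrongDual ℝ X).continuous
  obtain ⟨s, hs⟩ := hne
  obtain ⟨m, hm⟩ := exists_metric_sphere hF hlsc h
  refine @exists_denting_metric_of_polar X _ _ F p {x : X // p x = 1} m hp hlsc h Subtype.val
    -- The direction assigned to `0` is arbitrary, as its radius `p 0` is zero.
    (fun x => if hx : x = 0 then ⟨s, hs⟩ else ⟨(p x)⁻¹ • x, seminorm_inv_smul_self (hp.pos hx)⟩)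
    (fun x => ?_) ?_ ?_
  · rcases eq_or_ne x 0 with rfl | hx
    · simp
    · simp only [dif_neg hx, smul_inv_smul₀ (hp.pos hx).ne']
  · intro u s
    rw [hm]
    exact tendsto_nhds_sphere
  · intro f hf
    rw [hm]
    exact continuous_sphere hf

end Renorming

theorem mainTheorem7 {X : Type*} [NormedAddCommGroup X] [NormedSpace ℝ X]
    (F : Submodule ℝ (StrongDual ℝ X)) (hF : Renorming.IsNorming F) :
    (∃ p : Seminorm ℝ X, Renorming.IsEquivalentNorm p ∧ Renorming.IsSigmaLSC F p ∧
      ∀ (x : X) (u v : ℕ → X),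
        Tendsto (fun n => Renorming.convexityDefect p (u n) (v n)) atTop (𝓝 0) →
        Tendsto (fun n => Renorming.convexityDefect p x (u n)) atTop (𝓝 0) →
        Tendsto v atTop (@nhds X (Renorming.sigmaTopology F) x)) ↔
    (∃ p : Seminorm ℝ X, Renorming.IsEquivalentNorm p ∧ Renorming.IsSigmaLSC F p ∧
      ∃ d : MetricSpace X,
        d.toPseudoMetricSpace.toUniformSpace.toTopologicalSpace ≤ Renorming.sigmaTopology F ∧
        ∀ x : X, p x = 1 → Renorming.IsDentingPoint F p (fun y z => d.dist y z) x) := by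
  constructor
  · rintro ⟨p, hp, hlsc, h⟩
    exact ⟨p, hp, hlsc, Renorming.exists_denting_metric hF hp hlsc h⟩
  · rintro ⟨p, hp, hlsc, d, hdF, hd⟩
    exact Renorming.exists_norm_of_denting hp hlsc d hdF hd
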